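/- **Protocols.** A round-based register protocol is given by a finite set $Q$ of states with an initial state $q_0$, a number $d\in\mathbb N$ of registers per round, a finite data alphabet $D$ with an initial value $d_0\in D$, a visibility range $v\in\mathbb N$, and a set $\Delta\subseteq Q\times A\times Q$ of transitions, whose actions are $\mathsf{incr}$, $\mathsf{read}^{-i}_\alpha(x)$ ($0\le i\le v$, $1\le\alpha\le d$, $x\in D$) and $\mathsf{write}_\alpha(x)$ ($1\le\alpha\le d$, $x\in D\setminus\{d_0\}$). We write $\mathrm{rg}_k[\alpha]$ for register $\alpha$ of round $k$. **Abstract executions.** A configuration $\sigma$ consists of a set $\mathrm{loc}(\sigma)\subseteq Q\times\mathbb N$ of locations and a set $\mathrm{FW}(\sigma)$ of written registers (of rounds in $\mathbb N$); initially these are $\{(q_0,0)\}$ and $\emptyset$. A move $((q,a,q'),k)$ with $(q,a,q')\in\Delta$ and $k\in\mathbb N$ requires $(q,k)\in\mathrm{loc}(\sigma)$. It adds $(q',k+1)$ to $\mathrm{loc}(\sigma)$ if $a=\mathsf{incr}$, and $(q',k)$ otherwise; if $a=\mathsf{write}_\alpha(x)$, it also adds $\mathrm{rg}_k[\alpha]$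 to $\mathrm{FW}(\sigma)$. If $a=\mathsf{read}^{-i}_\alpha(d_0)$, it also requires $\mathrm{rg}_{k-i}[\alpha]\notin \mathrm{FW}(\sigma)$ (which always holds if $k-i<0$). If $a=\mathsf{read}^{-i}_\alpha(x)$ with $x\ne d_0$, it also requires $\mathrm{rg}_{k-i}[\alpha]\in \mathrm{FW}(\sigma)$ and a transition $(q_1,\mathsf{write}_\alpha(x),q_2)\in\Delta$ with $(q_1,k-i),(q_2,k-i)\in\mathrm{loc}(\sigma)$. An execution is a finite sequence of configurations linked by moves. Its first-write order $\mathrm{fwo}(\rho)$ is the sequence of the registers that it writes, in the order in which they are written for the first time. For a sequence $w$ of registers, $\mathrm{proj}_{[k,l]}(w)$ is its restriction to the registers of rounds $k$ to $l$. **The algorithm.** Let $F=(F_k)_{k\in\mathbb N}$ be a family of finite sequences of registers. It is *legal* if no $F_k$ has a repetition, $F_0$ has only registers of round $0$, and, for $k\ge1$, $F_k$ is obtained from $F_{k-1}$ by removing the registers of round $k-v-1$ and inserting registers of round $k$. For a prefix $f$ of $F_k$, let $\mathrm{sync}_{k-1,k}(f)$ be the longest prefix $p$ of $F_{k-1}$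 with $\mathrm{proj}_{[k-v,k-1]}(p)=\mathrm{proj}_{[k-v,k-1]}(f)$; let $\mathrm{sync}_{k,k}(f)=f$ and $\mathrm{sync}_{r,k}(f)=\mathrm{sync}_{r,r+1}(\mathrm{sync}_{r+1,k}(f))$ for $r<k-1$. The $F$-computation, for a legal $F$, starts with $S_0(\varepsilon)=\{q_0\}$ and all other variables $S_k(f)$ empty. For $k=0,1,2,\dots$, and for each prefix $f$ of $F_k$ by increasing length, it does the following. 1. If $f=g\cdot\mathrm{rg}$ for a register $\mathrm{rg}$, it adds $S_k(g)$ to $S_k(f)$. 2. If $k\ge1$, it adds to $S_k(f)$ all $q'$ such that $(q,\mathsf{incr},q')\in\Delta$ for some $q\in S_{k-1}(\mathrm{sync}_{k-1,k}(f))$. 3. If $f=g\cdot \mathrm{rg}_k[\alpha]$ and no transition $(q,\mathsf{write}_\alpha(x),q')\in\Delta$ with $x\neq d_0$ has $q\in S_k(g)$, it rejects. 4. It saturates $S_k(f)$: as long as possible, it adds $q'$ if there are $q\in S_k(f)$ and $(q,a,q')\in\Delta$ such that - $a=\mathsf{read}^{-j}_\alpha(d_0)$ and $\mathrm{rg}_{k-j}[\alpha]$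 is not in $f$; or - $a=\mathsf{read}^{-j}_\alpha(x)$ with $x\ne d_0$, $\mathrm{rg}_{k-j}[\alpha]$ is in $f$, and $(q_1,\mathsf{write}_\alpha(x),q_2)\in\Delta$ for some $q_1,q_2\in S_{k-j}(\mathrm{sync}_{k-j,k}(f))$; or - $a=\mathsf{write}_\alpha(x)$ and $\mathrm{rg}_k[\alpha]$ is in $f$. The $F$-computation is *non-rejecting* if $F$ is legal and step 3 never rejects. **Theorem.** For every round-based register protocol: 1. If the $F$-computation is non-rejecting, then for every $k\in\mathbb N$, from the end of round $k$ on, $S_k(F_k)$ is the set of all states $q$ for which there is an execution from the initial configuration to some configuration $\sigma$ such that $(q,k)\in\mathrm{loc}(\sigma)$ and the first-write order of the execution has projection $F_r$ on rounds $r-v$ to $r$, for all $r\le k$. 2. Conversely, for every execution $\rho$ from the initial configuration, letting $F_k=\mathrm{proj}_{[k-v,k]}(\mathrm{fwo}(\rho))$ for $k\in\mathbb N$, the $F$-computation is non-rejecting. -/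

import Mathlib

namespace RoundBased

/-- Register `α` of round `k` of a protocol with `d` registers per round
is the pair `(k, α)`. -/
abbrev Reg (d : ℕ) : Type := ℕ × Fin d

/-- Actions over the data alphabet `D`, with `d` registers per round:
`incr` increments the round, `read i α x` reads `x` from register `α` of `i` rounds before the
current one, `write α x` writes `x` to register `α` of the current round. -/
inductive Action (D : Type*) (d : ℕ) : Type _ where
  | incr : Action D d
  | read (i : ℕ) (α : Fin d) (x : D) : Action D d
  | write (α : Fin d) (x : D) : Action D d

/-- Round-based register protocols with set of states `Q` and data alphabet `D`: processes read at
most `vis` rounds back, and the initial value `blank` is never written. -/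
structure Protocol (Q : Type*) (D : Type*) where
  /-- the initial state -/
  start : Q
  /-- the number of registers per round -/
  dim : ℕ
  /-- the initial value of all registers -/
  blank : D
  /-- the visibility range -/
  vis : ℕ
  /-- the transitions -/
  trans : Set (Q × Action D dim × Q)
  read_le : ∀ q i α x q', (q, Action.read i α x, q') ∈ trans → i ≤ vis
  write_ne : ∀ q α x q', (q, Action.write α x, q') ∈ trans → x ≠ blank

variable {Q : Type*} {D : Type*}

/-! ### Abstract semantics -/

/-- Abstract configurations: the set of populated locations `(state, round)` and the set of
registers that have been written. -/
@[ext]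
structure Config (P : Protocol Q D) where
  locs : Set (Q × ℕ)
  written : Set (Reg P.dim)

/-- The initial configuration. -/
def initConfig (P : Protocol Q D) : Config P := ⟨{(P.start, 0)}, ∅⟩

/-- A move is a transition together with a round number; membership of the transition in
`P.trans` is required by `Step`. -/
abbrev Move (P : Protocol Q D) : Type _ := (Q × Action D P.dim × Q) × ℕ

/-- The successor relation on abstract configurations. Registers of negative rounds do not exist:
they are never written and always read as `blank`. -/
inductive Step (P : Protocol Q D) : Config P → Move P → Config P → Prop where
  | incr {σ : Config P} {q q' : Q} {k : ℕ}
      (ht : (q, Action.incr, q') ∈ P.trans) (hq : (q, k) ∈ σ.locs) :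
      Step P σ ((q, Action.incr, q'), k) ⟨σ.locs ∪ {(q', k + 1)}, σ.written⟩
  | readValue {σ : Config P} {q q' q₁ q₂ : Q} {k i r : ℕ} {α : Fin P.dim} {x : D}
      (ht : (q, Action.read i α x, q') ∈ P.trans) (hq : (q, k) ∈ σ.locs) (hx : x ≠ P.blank)
      (hr : r + i = k) (hw : (r, α) ∈ σ.written)
      (ht' : (q₁, Action.write α x, q₂) ∈ P.trans)
      (hq₁ : (q₁, r) ∈ σ.locs) (hq₂ : (q₂, r) ∈ σ.locs) :
      Step P σ ((q, Action.read i α x, q'), k) ⟨σ.locs ∪ {(q', k)}, σ.written⟩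
  | readBlank {σ : Config P} {q q' : Q} {k i : ℕ} {α : Fin P.dim}
      (ht : (q, Action.read i α P.blank, q') ∈ P.trans) (hq : (q, k) ∈ σ.locs)
      (hw : ∀ r, r + i = k → (r, α) ∉ σ.written) :
      Step P σ ((q, Action.read i α P.blank, q'), k) ⟨σ.locs ∪ {(q', k)}, σ.written⟩
  | write {σ : Config P} {q q' : Q} {k : ℕ} {α : Fin P.dim} {x : D}
      (ht : (q, Action.write α x, q') ∈ P.trans) (hq : (q, k) ∈ σ.locs) (hx : x ≠ P.blank) :
      Step P σ ((q, Action.write α x, q'), k) ⟨σ.locs ∪ {(q', k)}, σ.written ∪ {(k, α)}⟩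

/-- Abstract executions `σ →* τ`, as alternating sequences of configurations and moves. -/
inductive Exec (P : Protocol Q D) : Config P → Config P → Type _ where
  | nil (σ : Config P) : Exec P σ σ
  | snoc {σ τ τ' : Config P} (ρ : Exec P σ τ) (m : Move P) (h : Step P τ m τ') : Exec P σ τ'

/-! ### First-write orders -/

open Classical in
/-- The one-element sequence of the register that the move `m` first-writes from configuration
`τ`, or the empty sequence if `m` is not a first write. -/
noncomputable def firstWrite {P : Protocol Q D} (τ : Config P) (m : Move P) : List (Reg P.dim) :=
  match m with
  | ((_, Action.write α _, _), k) => if (k, α) ∈ τ.written then [] else [(k, α)]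
  | _ => []

/-- The first-write order of an execution. -/
noncomputable def fwo {P : Protocol Q D} {σ τ : Config P} : Exec P σ τ → List (Reg P.dim)
  | .nil _ => []
  | .snoc (τ := τ₀) ρ m _ => fwo ρ ++ firstWrite τ₀ m

/-- The restriction of a sequence of registers to rounds `lo` to `hi`. -/
def proj {d : ℕ} (lo hi : ℕ) (w : List (Reg d)) : List (Reg d) :=
  w.filter fun r => decide (lo ≤ r.1 ∧ r.1 ≤ hi)

/-- The restriction of a sequence of registers to the window of rounds `k - v, …, k`
(truncated at round `0`), where `v` is the visibility range. -/
def window (P : Protocol Q D) (k : ℕ) (w : List (Reg P.dim)) : List (Reg P.dim) :=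
  proj (k - P.vis) k w

/-- Families `(F_k)` of sequences of registers, one for each round `k`. -/
abbrev Family (P : Protocol Q D) : Type := ℕ → List (Reg P.dim)

/-- The states that are covered at round `k` by some execution from the initial configuration
whose first-write order has projection `F r` on the window of `r`, for all `r ≤ k`. -/
def stateReach (P : Protocol Q D) (F : Family P) (k : ℕ) : Set Q :=
  {q | ∃ (σ : Config P) (ρ : Exec P (initConfig P) σ),
    (q, k) ∈ σ.locs ∧ ∀ r ≤ k, window P r (fwo ρ) = F r}

/-! ### The algorithm -/

/-- The legal choices of the algorithm: `F 0` is a sequence of registers of round `0`, and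
`F (k + 1)` is obtained from `F k` by removing the registers of round `k - v` and inserting
registers of round `k + 1`. All these sequences are without repetition. -/
def IsChoice (P : Protocol Q D) (F : Family P) : ℕ → Prop
  | 0 => (F 0).Nodup ∧ ∀ r ∈ F 0, r.1 = 0
  | k + 1 => (F (k + 1)).Nodup ∧
      (F (k + 1)).filter (fun r => decide (r.1 ≠ k + 1)) =
        (F k).filter (fun r => decide (r.1 + P.vis ≠ k))

/-- The synchronisation from round `k + 1` to round `k`: the longest prefix of `F k` that coincides
with `f` on rounds `k + 1 - v` to `k`. -/
def syncStep (P : Protocol Q D) (F : Family P) (k : ℕ) (f : List (Reg P.dim)) :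
    List (Reg P.dim) :=
  ((F k).inits.filter fun p =>
    decide (proj (k + 1 - P.vis) k p = proj (k + 1 - P.vis) k f)).getLastD []

/-- The synchronisation of `f`, seen as a prefix of the sequence of round `k`, with an earlier
round `r`: the composition of the one-round synchronisations from `k` down to `r`. -/
def sync (P : Protocol Q D) (F : Family P) (r : ℕ) : ℕ → List (Reg P.dim) → List (Reg P.dim)
  | 0, f => f
  | k + 1, f => if r ≤ k then sync P F r k (syncStep P F k f) else f

/-- The contents of the variables `S_k(f)` of the algorithm. -/
abbrev Store (P : Protocol Q D) : Type _ := ℕ → List (Reg P.dim) → Set Q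

/-- The assignment `S_k(f) := X`. -/
def Store.assign {P : Protocol Q D} (S : Store P) (k : ℕ) (f : List (Reg P.dim)) (X : Set Q) :
    Store P :=
  Function.update S k (Function.update (S k) f X)

/-- The initialisation: `S_0(ε) = {q₀}` and all other variables are empty. -/
def initStore (P : Protocol Q D) : Store P :=
  Store.assign (fun _ _ => ∅) 0 [] {P.start}

/-- The states that are obtained at round `k` by `incr` moves from round `k - 1`. -/
def incrStates (P : Protocol Q D) (F : Family P) (S : Store P) (k : ℕ) (f : List (Reg P.dim)) :
    Set Q :=
  {q' | ∃ r, r + 1 = k ∧ ∃ q ∈ S r (sync P F r k f), (q, Action.incr, q') ∈ P.trans}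

/-- The first write to the last register of `f` is feasible at round `k`: if `f` is `g` followed by `(k, α)`
then some state of `S_k(g)` is the source of a write to `α`. (There is nothing to check if `f` is
empty or if its last register is not of round `k`.) -/
def Feasible (P : Protocol Q D) (S : Store P) (k : ℕ) (f : List (Reg P.dim)) : Prop :=
  ∀ g α, f = g ++ [(k, α)] →
    ∃ q x q', x ≠ P.blank ∧ (q, Action.write α x, q') ∈ P.trans ∧ q ∈ S k g

/-- With the current contents `S` of the variables, the action `a` is possible at round `k` under
progression `f`. -/
def Enabled (P : Protocol Q D) (F : Family P) (S : Store P) (k : ℕ) (f : List (Reg P.dim)) :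
    Action D P.dim → Prop
  | .incr => False
  | .read j α x =>
      (x = P.blank ∧ ∀ r, r + j = k → (r, α) ∉ f) ∨
      (x ≠ P.blank ∧ ∃ r, r + j = k ∧ (r, α) ∈ f ∧
        ∃ q₁ ∈ S r (sync P F r k f), ∃ q₂ ∈ S r (sync P F r k f),
          (q₁, Action.write α x, q₂) ∈ P.trans)
  | .write α _ => (k, α) ∈ f

/-- One pass of the saturation of `S_k(f)` by read and write moves at round `k`, applied to the
value `X` of `S_k(f)`. -/
def saturateStep (P : Protocol Q D) (F : Family P) (S : Store P) (k : ℕ) (f : List (Reg P.dim))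
    (X : Set Q) : Set Q :=
  X ∪ {q' | ∃ q ∈ X, ∃ a, (q, a, q') ∈ P.trans ∧ Enabled P F (S.assign k f X) k f a}

/-- The saturation of `S_k(f)` by read and write moves at round `k`. -/
def saturate (P : Protocol Q D) (F : Family P) (S : Store P) (k : ℕ) (f : List (Reg P.dim)) :
    Set Q :=
  ⋃ n : ℕ, (saturateStep P F S k f)^[n] (S k f)

open Classical in
/-- The body of the inner loop of the algorithm at round `k` and progression `f`;
`none` stands for rejection. -/
noncomputable def iteration (P : Protocol Q D) (F : Family P) (k : ℕ) (f : List (Reg P.dim))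
    (S : Store P) : Option (Store P) :=
  let S₁ := if f = [] then S else S.assign k f (S k f ∪ S k f.dropLast)
  let S₂ := S₁.assign k f (S₁ k f ∪ incrStates P F S₁ k f)
  if Feasible P S₂ k f then some (S₂.assign k f (saturate P F S₂ k f)) else none

/-- The contents of the variables after the rounds `0, …, K - 1` of the algorithm that chooses the
sequences `F`, or `none` if these rounds reject. -/
noncomputable def run (P : Protocol Q D) (F : Family P) : ℕ → Option (Store P)
  | 0 => some (initStore P)
  | K + 1 => (run P F K).bind fun S =>
      (List.range ((F K).length + 1)).foldlM (fun S i => iteration P F K ((F K).take i) S) S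

/-- The `F`-computation of the algorithm is a legal computation that never rejects. -/
def NonRejecting (P : Protocol Q D) (F : Family P) : Prop :=
  (∀ k, IsChoice P F k) ∧ ∀ K, run P F K ≠ none

end RoundBased

namespace RoundBased

variable {Q : Type*} {D : Type*}

/-! ### Lists -/

theorem longestPrefix_prefix {α : Type*} (p : List α → Bool) (l : List α) :
    (l.inits.filter p).getLastD [] <+: l := by
  induction l using List.reverseRecOn with
  | nil => by_cases h : p [] <;> simp [h]
  | append_singleton l x ih =>
    by_cases h : p (l ++ [x])
    · simp [List.inits_append, h]
    · simpa [List.inits_append, h] using ih.trans (List.prefix_append l [x])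

theorem longestPrefix_spec {α : Type*} (p : List α → Bool) (l : List α)
    (hl : ∃ a, a <+: l ∧ p a) :
    p ((l.inits.filter p).getLastD []) ∧
      ∀ a, a <+: l → p a → a <+: (l.inits.filter p).getLastD [] := by
  induction l using List.reverseRecOn with
  | nil =>
    obtain ⟨a, ha, hpa⟩ := hl
    obtain rfl : a = [] := by simpa using ha
    simp [hpa]
  | append_singleton l x ih =>
    by_cases h : p (l ++ [x])
    · simp [List.inits_append, h]
      intro a ha _
      exact ha
    · have hsub : ∀ a, a <+: l ++ [x] → p a → a <+: l := by
        intro a ha hpa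
        rcases List.prefix_concat_iff.1 ha with rfl | h'
        · exact absurd hpa h
        · exact h'
      obtain ⟨a, ha, hpa⟩ := hl
      have := ih ⟨a, hsub a ha hpa, hpa⟩
      have he : ((l ++ [x]).inits.filter p).getLastD [] = (l.inits.filter p).getLastD [] := by
        simp [List.inits_append, h]
      rw [he]
      exact ⟨this.1, fun b hb hpb => this.2 b (hsub b hb hpb) hpb⟩

/-- Two lists that agree on their common part can be merged, with the elements that are new in the
second list inserted as late as possible. -/
theorem exists_merge {α : Type*} (old new : α → Prop) [DecidablePred old] [DecidablePred new]
    (hd : ∀ x, new x → ¬ old x) (a b : List α)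
    (h : a.filter (fun x => ¬ old x) = b.filter (fun x => ¬ new x))
    (ha : ∀ x ∈ a, ¬ new x) (hb : ∀ x ∈ b, ¬ old x) :
    ∃ c : List α, c.filter (fun x => ¬ new x) = a ∧ c.filter (fun x => ¬ old x) = b ∧
      c.IsChain (fun y x => new y → ¬ old x) := by
  induction a generalizing b with
  | nil =>
    refine ⟨b, by simpa using h.symm, by simpa using hb, ?_⟩
    apply List.Pairwise.isChain
    exact List.pairwise_of_forall_mem_list fun _ _ y hy _ => hb y hy
  | cons x a iha =>
    have hax : ¬ new x := ha x (by simp)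
    have ha' : ∀ y ∈ a, ¬ new y := fun y hy => ha y (by simp [hy])
    by_cases hx : old x
    · obtain ⟨c, h1, h2, h3⟩ := iha b (by simpa [hx] using h) ha' hb
      refine ⟨x :: c, by simpa [hax] using h1, by simpa [hx] using h2, ?_⟩
      exact List.isChain_cons.2 ⟨fun y _ hn => absurd hn hax, h3⟩
    · induction b with
      | nil => simp [hx] at h
      | cons y b ihb =>
        have hby : ¬ old y := hb y (by simp)
        have hb' : ∀ z ∈ b, ¬ old z := fun z hz => hb z (by simp [hz])
        by_cases hy : new y
        · obtain ⟨c, h1, h2, h3⟩ := ihb (by simpa [hx, hy] using h) hb'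
          refine ⟨y :: c, by simpa [hy] using h1, by simpa [hby] using h2, ?_⟩
          refine List.isChain_cons.2 ⟨fun z hz _ ho => ?_, h3⟩
          obtain ⟨c', rfl⟩ : ∃ c', c = z :: c' := by
            cases c with
            | nil => simp at hz
            | cons u c' => exact ⟨c', by simp at hz; rw [hz]⟩
          have hz' : ¬ new z := fun hn => hd z hn ho
          rw [List.filter_cons_of_pos (by simpa using hz')] at h1
          exact hx ((List.cons.inj h1).1 ▸ ho)
        · rw [List.filter_cons_of_pos (by simpa using hx),
            List.filter_cons_of_pos (by simpa using hy)] at h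
          obtain ⟨rfl, ht⟩ := List.cons.inj h
          obtain ⟨c, h1, h2, h3⟩ := iha b ht ha' hb'
          refine ⟨x :: c, by simpa [hax] using h1, by simpa [hx] using h2, ?_⟩
          exact List.isChain_cons.2 ⟨fun y _ hn => absurd hn hax, h3⟩

/-! ### Windows and synchronisation -/

variable {P : Protocol Q D} {F : Family P}

theorem mem_window {k : ℕ} {w : List (Reg P.dim)} {e : Reg P.dim} :
    e ∈ window P k w ↔ e ∈ w ∧ e.1 ≤ k ∧ k ≤ e.1 + P.vis := by
  simp only [window, proj, List.mem_filter, decide_eq_true_eq]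
  have : k - P.vis ≤ e.1 ∧ e.1 ≤ k ↔ e.1 ≤ k ∧ k ≤ e.1 + P.vis := by omega
  rw [this]

theorem window_append (k : ℕ) (u w : List (Reg P.dim)) :
    window P k (u ++ w) = window P k u ++ window P k w := by
  simp [window, proj]

theorem window_prefix {k : ℕ} {u w : List (Reg P.dim)} (h : u <+: w) :
    window P k u <+: window P k w := by
  obtain ⟨t, rfl⟩ := h
  rw [window_append]
  exact List.prefix_append _ _

theorem window_singleton_of_mem {k : ℕ} {e : Reg P.dim} (h1 : e.1 ≤ k) (h2 : k ≤ e.1 + P.vis) :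
    window P k [e] = [e] := by
  simp [window, proj, h1, h2]

/-- A nonempty window of `p` ending in `e` is reached when `e` is appended. -/
theorem window_eq_concat {k : ℕ} {p g : List (Reg P.dim)} {e : Reg P.dim}
    (h : window P k p = g ++ [e]) :
    ∃ p₁ p₂, p = p₁ ++ e :: p₂ ∧ window P k p₁ = g ∧ e.1 ≤ k ∧ k ≤ e.1 + P.vis := by
  have he : e ∈ window P k p := by simp [h]
  obtain ⟨-, h1, h2⟩ := mem_window.1 he
  obtain ⟨l₁, l₂, rfl, hl₁, hl₂⟩ := List.filter_eq_append_iff.1 h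
  obtain ⟨m₁, m₂, rfl, hm₁, -, hm₂⟩ := List.filter_eq_cons_iff.1 hl₂
  refine ⟨l₁ ++ m₁, m₂, by simp, ?_, h1, h2⟩
  rw [window_append]
  have : window P k m₁ = [] := by
    simpa [window, proj] using hm₁
  rw [this, List.append_nil]
  exact hl₁

/-- Prefixes of a window are windows of prefixes. -/
theorem prefix_window {k : ℕ} {f w : List (Reg P.dim)} (h : f <+: window P k w) :
    ∃ p, p <+: w ∧ window P k p = f := by
  obtain ⟨t, ht⟩ := h
  obtain ⟨l₁, l₂, rfl, hl₁, -⟩ := List.filter_eq_append_iff.1 ht.symm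
  exact ⟨l₁, List.prefix_append _ _, hl₁⟩

theorem proj_window_succ (k : ℕ) (w : List (Reg P.dim)) :
    proj (k + 1 - P.vis) k (window P (k + 1) w) = proj (k + 1 - P.vis) k w := by
  simp only [window, proj, List.filter_filter]
  apply List.filter_congr
  intro e _
  rw [← Bool.decide_and, decide_eq_decide]
  omega

theorem proj_window (k : ℕ) (w : List (Reg P.dim)) :
    proj (k + 1 - P.vis) k (window P k w) = proj (k + 1 - P.vis) k w := by
  simp only [window, proj, List.filter_filter]
  apply List.filter_congr
  intro e _
  rw [← Bool.decide_and, decide_eq_decide]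
  omega

theorem syncStep_prefix (k : ℕ) (f : List (Reg P.dim)) : syncStep P F k f <+: F k :=
  longestPrefix_prefix _ _

theorem syncStep_spec {k : ℕ} {p w : List (Reg P.dim)} (hw : window P k w = F k) (hp : p <+: w) :
    proj (k + 1 - P.vis) k (syncStep P F k (window P (k + 1) p)) = proj (k + 1 - P.vis) k p ∧
      window P k p <+: syncStep P F k (window P (k + 1) p) := by
  have hpre : window P k p <+: F k := hw ▸ window_prefix hp
  have hproj : proj (k + 1 - P.vis) k (window P k p) =
      proj (k + 1 - P.vis) k (window P (k + 1) p) := by rw [proj_window, proj_window_succ]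
  have := longestPrefix_spec
    (fun q => decide (proj (k + 1 - P.vis) k q = proj (k + 1 - P.vis) k (window P (k + 1) p)))
    (F k) ⟨_, hpre, by simpa using hproj⟩
  refine ⟨?_, this.2 _ hpre (by simpa using hproj)⟩
  rw [← proj_window_succ (P := P) k p]
  exact of_decide_eq_true this.1

theorem sync_self (k : ℕ) (f : List (Reg P.dim)) : sync P F k k f = f := by
  cases k <;> simp [sync]

theorem sync_succ {r k : ℕ} (h : r ≤ k) (f : List (Reg P.dim)) :
    sync P F r (k + 1) f = sync P F r k (syncStep P F k f) := by
  simp [sync, h]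

theorem sync_prefix {r k : ℕ} (h : r < k) (f : List (Reg P.dim)) : sync P F r k f <+: F r := by
  induction k generalizing f with
  | zero => omega
  | succ k ih =>
    rw [sync_succ (by omega)]
    rcases Nat.lt_or_ge r k with h' | h'
    · exact ih h' _
    · obtain rfl : r = k := by omega
      rw [sync_self]
      exact syncStep_prefix _ _

theorem window_prefix_sync {K : ℕ} {w : List (Reg P.dim)} (hw : ∀ r ≤ K, window P r w = F r)
    {r k : ℕ} (hrk : r ≤ k) (hk : k ≤ K) {p : List (Reg P.dim)} (hp : p <+: w) :
    window P r p <+: sync P F r k (window P k p) := by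
  induction k generalizing p with
  | zero =>
    obtain rfl : r = 0 := by omega
    rw [sync_self]
  | succ k ih =>
    rcases Nat.lt_or_ge k r with h | h
    · obtain rfl : r = k + 1 := by omega
      rw [sync_self]
    · rw [sync_succ h]
      have hs := (syncStep_spec (hw k (by omega)) hp).2
      have hF := syncStep_prefix (F := F) k (window P (k + 1) p)
      rw [← hw k (by omega)] at hF
      obtain ⟨p', hp', he⟩ := prefix_window hF
      rw [← he] at hs ⊢
      rcases List.prefix_or_prefix_of_prefix hp hp' with h1 | h1
      · exact (window_prefix h1).trans (ih h (by omega) hp')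
      · have : window P k p' = window P k p :=
          (window_prefix h1).eq_of_length_le hs.length_le
        rw [this]
        exact ih h (by omega) hp

/-! ### The fixed point computed by the algorithm -/

/-- The least fixed point of the rules of the algorithm, without the rejection test: the states
that belong to `S_k(f)`. -/
inductive Cov (P : Protocol Q D) (F : Family P) : ℕ → List (Reg P.dim) → Q → Prop where
  | start : Cov P F 0 [] P.start
  | ext {k : ℕ} {g : List (Reg P.dim)} {e : Reg P.dim} {q : Q} (h : Cov P F k g q) :
      Cov P F k (g ++ [e]) q
  | incr {k : ℕ} {f : List (Reg P.dim)} {q q' : Q}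
      (h : Cov P F k (sync P F k (k + 1) f) q) (ht : (q, Action.incr, q') ∈ P.trans) :
      Cov P F (k + 1) f q'
  | readBlank {k j : ℕ} {α : Fin P.dim} {f : List (Reg P.dim)} {q q' : Q} (h : Cov P F k f q)
      (ht : (q, Action.read j α P.blank, q') ∈ P.trans) (hf : ∀ r, r + j = k → (r, α) ∉ f) :
      Cov P F k f q'
  | readValue {k j r : ℕ} {α : Fin P.dim} {x : D} {f : List (Reg P.dim)} {q q' q₁ q₂ : Q}
      (h : Cov P F k f q) (ht : (q, Action.read j α x, q') ∈ P.trans) (hx : x ≠ P.blank)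
      (hr : r + j = k) (hf : (r, α) ∈ f) (h₁ : Cov P F r (sync P F r k f) q₁)
      (h₂ : Cov P F r (sync P F r k f) q₂) (ht' : (q₁, Action.write α x, q₂) ∈ P.trans) :
      Cov P F k f q'
  | write {k : ℕ} {α : Fin P.dim} {x : D} {f : List (Reg P.dim)} {q q' : Q} (h : Cov P F k f q)
      (ht : (q, Action.write α x, q') ∈ P.trans) (hf : (k, α) ∈ f) : Cov P F k f q'

theorem Cov.mono {k : ℕ} {f f' : List (Reg P.dim)} {q : Q} (h : Cov P F k f q) (hf : f <+: f') :
    Cov P F k f' q := by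
  obtain ⟨t, rfl⟩ := hf
  induction t using List.reverseRecOn with
  | nil => simpa using h
  | append_singleton t e ih =>
    rw [← List.append_assoc]
    exact ih.ext

/-- The rejection test at `(k, f)`, relative to the fixed point. -/
def CovFeasible (P : Protocol Q D) (F : Family P) (k : ℕ) (f : List (Reg P.dim)) : Prop :=
  ∀ g α, f = g ++ [(k, α)] →
    ∃ q x q', x ≠ P.blank ∧ (q, Action.write α x, q') ∈ P.trans ∧ Cov P F k g q

/-- The variables that are final when round `k` has processed the prefixes of length `< i`. -/
def Final (F : Family P) (k i r : ℕ) (f : List (Reg P.dim)) : Prop :=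
  f <+: F r ∧ (r < k ∨ r = k ∧ f.length < i)

/-- The final variables hold the fixed point, the other ones their initial contents. -/
def StoreInv (F : Family P) (S : Store P) (k i : ℕ) : Prop :=
  (∀ r f, Final F k i r f → S r f = {q | Cov P F r f q}) ∧
    ∀ r f, ¬ Final F k i r f → S r f = initStore P r f

theorem Store.assign_self (S : Store P) (k : ℕ) (f : List (Reg P.dim)) (X : Set Q) :
    S.assign k f X k f = X := by
  simp [Store.assign]

theorem Store.assign_of_ne (S : Store P) {k r : ℕ} {f g : List (Reg P.dim)} (X : Set Q)
    (h : r ≠ k ∨ g ≠ f) : S.assign k f X r g = S r g := by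
  by_cases hr : r = k
  · subst hr
    simp [Store.assign, Function.update_of_ne (h.resolve_left (by simp))]
  · simp [Store.assign, hr]

theorem initStore_apply {r : ℕ} {f : List (Reg P.dim)} {q : Q} :
    q ∈ initStore P r f ↔ r = 0 ∧ f = [] ∧ q = P.start := by
  by_cases h : r = 0 ∧ f = []
  · obtain ⟨rfl, rfl⟩ := h
    simp [initStore, Store.assign_self]
  · rw [initStore, Store.assign_of_ne _ _ (by tauto)]
    simp
    tauto

theorem saturate_eq {k i : ℕ} {S S₂ : Store P} (hi : i ≤ (F k).length) (hS : StoreInv F S k i)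
    (hother : ∀ r g, r ≠ k ∨ g ≠ (F k).take i → S₂ r g = S r g)
    (hbase : ∀ q, q ∈ S₂ k ((F k).take i) ↔ q ∈ initStore P k ((F k).take i) ∨
      ((F k).take i ≠ [] ∧ Cov P F k ((F k).take i).dropLast q) ∨
      ∃ r, r + 1 = k ∧ ∃ q₀, Cov P F r (sync P F r k ((F k).take i)) q₀ ∧
        (q₀, Action.incr, q) ∈ P.trans) :
    saturate P F S₂ k ((F k).take i) = {q | Cov P F k ((F k).take i) q} := by
  set f := (F k).take i with hf
  have hfin : ∀ r, r < k → S₂ r (sync P F r k f) = {q | Cov P F r (sync P F r k f) q} := by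
    intro r hr
    rw [hother _ _ (Or.inl hr.ne)]
    exact hS.1 _ _ ⟨sync_prefix hr f, Or.inl hr⟩
  have hmono : Monotone fun n => (saturateStep P F S₂ k f)^[n] (S₂ k f) := by
    apply monotone_nat_of_le_succ
    intro n
    simp only [Function.iterate_succ_apply']
    exact Set.subset_union_left
  apply Set.Subset.antisymm
  · intro q hq
    obtain ⟨n, hn⟩ := Set.mem_iUnion.1 hq
    clear hq
    induction n generalizing q with
    | zero =>
      rcases (hbase q).1 hn with h | ⟨hne, h⟩ | ⟨r, rfl, q₀, h, ht⟩
      · obtain ⟨rfl, h0, rfl⟩ := initStore_apply.1 h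
        rw [h0]
        exact Cov.start
      · exact h.mono (List.dropLast_prefix f)
      · exact h.incr ht
    | succ n ih =>
      rw [Function.iterate_succ_apply'] at hn
      rcases hn with hn | ⟨q₀, hq₀, a, ht, ha⟩
      · exact ih hn
      · have h₀ : Cov P F k f q₀ := ih hq₀
        cases a with
        | incr => exact ha.elim
        | write α x => exact h₀.write ht ha
        | read j α x =>
          rcases ha with ⟨rfl, h⟩ | ⟨hx, r, hr, hrf, q₁, hq₁, q₂, hq₂, ht'⟩
          · exact h₀.readBlank ht h
          · have key : ∀ q, q ∈ (S₂.assign k f ((saturateStep P F S₂ k f)^[n] (S₂ k f))) r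
                (sync P F r k f) → Cov P F r (sync P F r k f) q := by
              intro q hq
              rcases Nat.lt_or_ge r k with h | h
              · rw [Store.assign_of_ne _ _ (Or.inl h.ne), hfin r h] at hq
                exact hq
              · obtain rfl : r = k := by omega
                rw [sync_self] at hq ⊢
                rw [Store.assign_self] at hq
                exact ih hq
            exact h₀.readValue ht hx hr hrf (key _ hq₁) (key _ hq₂) ht'
  · intro q (hq : Cov P F k f q)
    suffices H : ∀ k' f' q, Cov P F k' f' q → k' = k → f' = f →
        ∃ n, q ∈ (saturateStep P F S₂ k f)^[n] (S₂ k f) by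
      exact Set.mem_iUnion.2 (H _ _ _ hq rfl rfl)
    have step : ∀ (n : ℕ) (q q' : Q) (a : Action D P.dim),
        q ∈ (saturateStep P F S₂ k f)^[n] (S₂ k f) → (q, a, q') ∈ P.trans →
        Enabled P F (S₂.assign k f ((saturateStep P F S₂ k f)^[n] (S₂ k f))) k f a →
        ∃ n, q' ∈ (saturateStep P F S₂ k f)^[n] (S₂ k f) := by
      intro n q q' a h1 h2 h3
      refine ⟨n + 1, ?_⟩
      rw [Function.iterate_succ_apply']
      exact Or.inr ⟨q, h1, a, h2, h3⟩
    intro k' f' q h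
    induction h with
    | start =>
      intro hk hf'
      exact ⟨0, (hbase _).2 (Or.inl (initStore_apply.2 ⟨hk.symm, hf'.symm, rfl⟩))⟩
    | @ext k' g e q h ih =>
      rintro rfl hf'
      refine ⟨0, (hbase _).2 (Or.inr (Or.inl ?_))⟩
      rw [← hf']
      simpa using h
    | @incr k' f' q q' h ht ih =>
      rintro rfl rfl
      exact ⟨0, (hbase _).2 (Or.inr (Or.inr ⟨k', rfl, q, h, ht⟩))⟩
    | readBlank h ht hr ih =>
      rintro rfl rfl
      obtain ⟨n, hn⟩ := ih rfl rfl
      exact step n _ _ _ hn ht (Or.inl ⟨rfl, hr⟩)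
    | @readValue k' j r α x f' q q' q₁ q₂ h ht hx hr hrf h₁ h₂ ht' ih ih₁ ih₂ =>
      rintro rfl rfl
      obtain ⟨n, hn⟩ := ih rfl rfl
      rcases Nat.lt_or_ge r k' with hlt | hge
      · refine step n _ _ _ hn ht (Or.inr ⟨hx, r, hr, hrf, q₁, ?_, q₂, ?_, ht'⟩)
        · rw [Store.assign_of_ne _ _ (Or.inl hlt.ne), hfin r hlt]
          exact h₁
        · rw [Store.assign_of_ne _ _ (Or.inl hlt.ne), hfin r hlt]
          exact h₂
      · obtain rfl : r = k' := by omega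
        rw [sync_self] at ih₁ ih₂
        obtain ⟨n₁, hn₁⟩ := ih₁ rfl rfl
        obtain ⟨n₂, hn₂⟩ := ih₂ rfl rfl
        refine step (max n (max n₁ n₂)) _ _ _ (hmono (le_max_left _ _) hn) ht
          (Or.inr ⟨hx, r, hr, hrf, q₁, ?_, q₂, ?_, ht'⟩)
        · rw [sync_self, Store.assign_self]
          exact hmono (by simp) hn₁
        · rw [sync_self, Store.assign_self]
          exact hmono (by simp) hn₂
    | write h ht hr ih =>
      rintro rfl rfl
      obtain ⟨n, hn⟩ := ih rfl rfl
      exact step n _ _ _ hn ht hr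

theorem final_dropLast {k i : ℕ} (hi : i ≤ (F k).length) (hne : (F k).take i ≠ []) :
    Final F k i k ((F k).take i).dropLast := by
  refine ⟨(List.dropLast_prefix _).trans (List.take_prefix _ _), Or.inr ⟨rfl, ?_⟩⟩
  have := List.length_pos_iff.2 hne
  simp only [List.length_dropLast, List.length_take] at this ⊢
  omega

open Classical in
theorem iteration_spec {k i : ℕ} {S : Store P} (hi : i ≤ (F k).length) (hS : StoreInv F S k i) :
    (∃ S', iteration P F k ((F k).take i) S = some S' ∧ StoreInv F S' k (i + 1) ∧
      CovFeasible P F k ((F k).take i)) ∨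
    (iteration P F k ((F k).take i) S = none ∧ ¬ CovFeasible P F k ((F k).take i)) := by
  set f := (F k).take i with hf
  have hlen : f.length = i := by simp [hf, hi]
  have hnf : ¬ Final F k i k f := by
    rintro ⟨-, h | ⟨-, h⟩⟩ <;> omega
  set S₁ := if f = [] then S else S.assign k f (S k f ∪ S k f.dropLast) with hS₁
  set S₂ := S₁.assign k f (S₁ k f ∪ incrStates P F S₁ k f) with hS₂
  have h₁ : ∀ r g, r ≠ k ∨ g ≠ f → S₁ r g = S r g := by
    intro r g h
    rw [hS₁]
    split_ifs
    · rfl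
    · exact Store.assign_of_ne _ _ h
  have h₂ : ∀ r g, r ≠ k ∨ g ≠ f → S₂ r g = S r g := by
    intro r g h
    rw [hS₂, Store.assign_of_ne _ _ h, h₁ r g h]
  have hbase : ∀ q, q ∈ S₂ k f ↔ q ∈ initStore P k f ∨ (f ≠ [] ∧ Cov P F k f.dropLast q) ∨
      ∃ r, r + 1 = k ∧ ∃ q₀, Cov P F r (sync P F r k f) q₀ ∧ (q₀, Action.incr, q) ∈ P.trans := by
    intro q
    have e1 : q ∈ S₁ k f ↔ q ∈ initStore P k f ∨ (f ≠ [] ∧ Cov P F k f.dropLast q) := by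
      by_cases hne : f = []
      · have e : S₁ k f = initStore P k f := by rw [hS₁, if_pos hne, hS.2 k f hnf]
        rw [e]
        simp [hne]
      · have e : S₁ k f = initStore P k f ∪ {q | Cov P F k f.dropLast q} := by
          rw [hS₁, if_neg hne, Store.assign_self, hS.2 k f hnf, hS.1 k _ (final_dropLast hi hne)]
        rw [e]
        simp [hne]
    have e2 : q ∈ incrStates P F S₁ k f ↔ ∃ r, r + 1 = k ∧ ∃ q₀, Cov P F r (sync P F r k f) q₀ ∧
        (q₀, Action.incr, q) ∈ P.trans := by
      unfold incrStates
      rw [Set.mem_ofPred_eq]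
      refine exists_congr fun r => and_congr_right fun hr => exists_congr fun q₀ => ?_
      have hlt : r < k := by omega
      rw [h₁ _ _ (Or.inl hlt.ne), hS.1 _ _ ⟨sync_prefix hlt f, Or.inl hlt⟩]
      rfl
    rw [hS₂, Store.assign_self, Set.mem_union, e1, e2, or_assoc]
  have hfeas : Feasible P S₂ k f ↔ CovFeasible P F k f := by
    refine forall_congr' fun g => forall_congr' fun α => forall_congr' fun hg => ?_
    have hgf : g ≠ f := fun h => by simpa [h] using congrArg List.length hg
    have hgF : Final F k i k g := by
      refine ⟨?_, Or.inr ⟨rfl, ?_⟩⟩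
      · exact (hg ▸ List.prefix_append _ _ : g <+: f).trans (List.take_prefix _ _)
      · have := congrArg List.length hg
        simp [hlen] at this
        omega
    rw [h₂ _ _ (Or.inr hgf), hS.1 _ _ hgF]
    rfl
  have hit : iteration P F k f S =
      if Feasible P S₂ k f then some (S₂.assign k f (saturate P F S₂ k f)) else none := rfl
  by_cases hc : CovFeasible P F k f
  · left
    refine ⟨_, by rw [hit, if_pos (hfeas.2 hc)], ?_, hc⟩
    have hsucc : ∀ r g, Final F k (i + 1) r g ↔ Final F k i r g ∨ (r = k ∧ g = f) := by
      intro r g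
      constructor
      · rintro ⟨hp, h | ⟨rfl, h⟩⟩
        · exact Or.inl ⟨hp, Or.inl h⟩
        · rcases Nat.lt_or_ge g.length i with h' | h'
          · exact Or.inl ⟨hp, Or.inr ⟨rfl, h'⟩⟩
          · refine Or.inr ⟨rfl, ?_⟩
            have : g.length = i := by omega
            rw [hf, ← this]
            exact List.prefix_iff_eq_take.1 hp
      · rintro (⟨hp, h⟩ | ⟨rfl, rfl⟩)
        · exact ⟨hp, by omega⟩
        · exact ⟨List.take_prefix _ _, Or.inr ⟨rfl, by omega⟩⟩
    constructor
    · intro r g h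
      by_cases hrg : r = k ∧ g = f
      · obtain ⟨rfl, rfl⟩ := hrg
        rw [Store.assign_self]
        exact saturate_eq hi hS h₂ hbase
      · rw [Store.assign_of_ne _ _ (by tauto), h₂ _ _ (by tauto)]
        exact hS.1 _ _ (((hsucc r g).1 h).resolve_right hrg)
    · intro r g h
      rw [hsucc] at h
      rw [Store.assign_of_ne _ _ (by tauto), h₂ _ _ (by tauto)]
      exact hS.2 _ _ (by tauto)
  · right
    exact ⟨by rw [hit, if_neg (fun h => hc (hfeas.1 h))], hc⟩

theorem round_spec {k : ℕ} {S : Store P} (hS : StoreInv F S k 0) (n : ℕ)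
    (hn : n ≤ (F k).length + 1) :
    (∃ S', (List.range n).foldlM (fun S i => iteration P F k ((F k).take i) S) S = some S' ∧
      StoreInv F S' k n ∧ ∀ i < n, CovFeasible P F k ((F k).take i)) ∨
    ((List.range n).foldlM (fun S i => iteration P F k ((F k).take i) S) S = none ∧
      ∃ i, ¬ CovFeasible P F k ((F k).take i)) := by
  induction n with
  | zero => exact Or.inl ⟨S, rfl, hS, by simp⟩
  | succ n ih =>
    rw [List.range_succ, List.foldlM_append]
    rcases ih (by omega) with ⟨S', h1, h2, h3⟩ | ⟨h1, h2⟩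
    · rw [h1]
      rcases iteration_spec (by omega) h2 with ⟨S'', g1, g2, g3⟩ | ⟨g1, g2⟩
      · refine Or.inl ⟨S'', by simp [g1], g2, fun i hi => ?_⟩
        rcases Nat.lt_or_ge i n with h | h
        · exact h3 i h
        · obtain rfl : i = n := by omega
          exact g3
      · exact Or.inr ⟨by simp [g1], _, g2⟩
    · exact Or.inr ⟨by simp [h1], h2⟩

theorem storeInv_succ {k : ℕ} {S : Store P} (h : StoreInv F S k ((F k).length + 1)) :
    StoreInv F S (k + 1) 0 := by
  have : ∀ r f, Final F (k + 1) 0 r f ↔ Final F k ((F k).length + 1) r f := by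
    intro r f
    refine and_congr_right fun hp => ?_
    constructor
    · intro h
      rcases Nat.lt_or_ge r k with h' | h'
      · exact Or.inl h'
      · obtain rfl : r = k := by omega
        exact Or.inr ⟨rfl, Nat.lt_succ_of_le hp.length_le⟩
    · omega
  exact ⟨fun r f hf => h.1 r f ((this r f).1 hf),
    fun r f hf => h.2 r f (fun h' => hf ((this r f).2 h'))⟩

theorem run_spec (P : Protocol Q D) (F : Family P) (K : ℕ) :
    (∃ S, run P F K = some S ∧ StoreInv F S K 0 ∧
      ∀ k < K, ∀ f, f <+: F k → CovFeasible P F k f) ∨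
    (run P F K = none ∧ ∃ k f, f <+: F k ∧ ¬ CovFeasible P F k f) := by
  induction K with
  | zero =>
    refine Or.inl ⟨_, rfl, ⟨fun r f h => ?_, fun r f _ => rfl⟩, by simp⟩
    have := h.2
    omega
  | succ K ih =>
    rcases ih with ⟨S, h1, h2, h3⟩ | ⟨h1, h2⟩
    · have hrun : run P F (K + 1) = (List.range ((F K).length + 1)).foldlM
          (fun S i => iteration P F K ((F K).take i) S) S := by
        simp only [run, h1, Option.bind_some]
      rcases round_spec h2 _ le_rfl with ⟨S', g1, g2, g3⟩ | ⟨g1, i, g2⟩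
      · refine Or.inl ⟨S', hrun.trans g1, storeInv_succ g2, fun k hk f hf => ?_⟩
        rcases Nat.lt_or_ge k K with h | h
        · exact h3 k h f hf
        · obtain rfl : k = K := by omega
          rw [List.prefix_iff_eq_take.1 hf]
          exact g3 _ (Nat.lt_succ_of_le hf.length_le)
      · exact Or.inr ⟨hrun.trans g1, K, _, List.take_prefix i _, g2⟩
    · exact Or.inr ⟨by simp only [run, h1, Option.bind_none], h2⟩

theorem run_ne_none_iff (P : Protocol Q D) (F : Family P) :
    (∀ K, run P F K ≠ none) ↔ ∀ k f, f <+: F k → CovFeasible P F k f := by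
  constructor
  · intro h k f hf
    rcases run_spec P F (k + 1) with ⟨S, -, -, h3⟩ | ⟨h1, -⟩
    · exact h3 k (by omega) f hf
    · exact absurd h1 (h _)
  · intro h K hK
    rcases run_spec P F K with ⟨S, h1, -⟩ | ⟨-, k, f, hf, hn⟩
    · simp [h1] at hK
    · exact hn (h k f hf)

theorem run_eq_of_ne_none {K : ℕ} (h : run P F K ≠ none) :
    ∃ S, run P F K = some S ∧ ∀ k < K, S k (F k) = {q | Cov P F k (F k) q} := by
  rcases run_spec P F K with ⟨S, h1, h2, -⟩ | ⟨h1, -⟩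
  · exact ⟨S, h1, fun k hk => h2.1 _ _ ⟨List.prefix_rfl, Or.inl hk⟩⟩
  · exact absurd h1 h

/-! ### Executions and their first-write orders -/

/-- `σ` is reachable from the initial configuration by an execution with first-write order `w`. -/
def Reach (P : Protocol Q D) (w : List (Reg P.dim)) (σ : Config P) : Prop :=
  ∃ ρ : Exec P (initConfig P) σ, fwo ρ = w

theorem Reach.step {w : List (Reg P.dim)} {σ τ : Config P} {m : Move P} (h : Reach P w σ)
    (hm : Step P σ m τ) : Reach P (w ++ firstWrite σ m) τ := by
  obtain ⟨ρ, rfl⟩ := h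
  exact ⟨ρ.snoc m hm, rfl⟩

theorem Reach.induction {motive : ∀ w σ, Reach P w σ → Prop}
    (init : motive [] (initConfig P) ⟨.nil _, rfl⟩)
    (step : ∀ w σ m τ (h : Reach P w σ) (_ : motive w σ h) (hs : Step P σ m τ),
      motive (w ++ firstWrite σ m) τ (h.step hs))
    {w : List (Reg P.dim)} {σ : Config P} (h : Reach P w σ) : motive w σ h := by
  obtain ⟨ρ, rfl⟩ := h
  induction ρ with
  | nil => exact init
  | snoc ρ m h ih => exact step _ _ m _ ⟨ρ, rfl⟩ ih h

theorem firstWrite_write_of_mem {σ : Config P} {q q' : Q} {α : Fin P.dim} {x : D} {k : ℕ}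
    (h : (k, α) ∈ σ.written) : firstWrite σ ((q, Action.write α x, q'), k) = [] := by
  simp [firstWrite, h]

theorem firstWrite_write_of_notMem {σ : Config P} {q q' : Q} {α : Fin P.dim} {x : D} {k : ℕ}
    (h : (k, α) ∉ σ.written) : firstWrite σ ((q, Action.write α x, q'), k) = [(k, α)] := by
  simp [firstWrite, h]

theorem Reach.mem_written {w : List (Reg P.dim)} {σ : Config P} (h : Reach P w σ)
    {e : Reg P.dim} : e ∈ σ.written ↔ e ∈ w := by
  induction h using Reach.induction generalizing e with
  | init => simp [initConfig]
  | step w σ m τ _ ih hs =>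
    cases hs with
    | incr => simpa [firstWrite] using ih
    | readValue => simpa [firstWrite] using ih
    | readBlank => simpa [firstWrite] using ih
    | @write q q' k α x =>
      by_cases hk : (k, α) ∈ σ.written
      · rw [firstWrite_write_of_mem hk]
        simp only [Set.union_singleton, Set.mem_insert_iff, List.append_nil, ← ih]
        exact or_iff_right_of_imp fun he => he ▸ hk
      · rw [firstWrite_write_of_notMem hk]
        simp only [Set.union_singleton, Set.mem_insert_iff, List.mem_append, List.mem_singleton,
          ← ih]
        exact or_comm

theorem Reach.nodup {w : List (Reg P.dim)} {σ : Config P} (h : Reach P w σ) : w.Nodup := by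
  induction h using Reach.induction with
  | init => simp
  | step w σ m τ h ih hs =>
    cases hs with
    | incr => simpa [firstWrite] using ih
    | readValue => simpa [firstWrite] using ih
    | readBlank => simpa [firstWrite] using ih
    | @write q q' k α x =>
      by_cases hk : (k, α) ∈ σ.written
      · rwa [firstWrite_write_of_mem hk, List.append_nil]
      · rw [firstWrite_write_of_notMem hk]
        refine List.nodup_append.2 ⟨ih, by simp, fun a ha b hb => ?_⟩
        rintro rfl
        obtain rfl := List.mem_singleton.1 hb
        exact hk (h.mem_written.2 ha)

theorem Reach.start_mem {w : List (Reg P.dim)} {σ : Config P} (h : Reach P w σ) :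
    (P.start, 0) ∈ σ.locs := by
  induction h using Reach.induction with
  | init => simp [initConfig]
  | step w σ m τ _ ih hs => cases hs <;> exact Or.inl ih

/-! ### The algorithm covers all executions -/

theorem Reach.cov {K : ℕ} {w : List (Reg P.dim)} (hw : ∀ r ≤ K, window P r w = F r)
    {u : List (Reg P.dim)} {σ : Config P} (h : Reach P u σ) (hu : u <+: w) :
    (∀ r ≤ K, ∀ q, (q, r) ∈ σ.locs → Cov P F r (window P r u) q) ∧
      ∀ r ≤ K, ∀ f, f <+: window P r u → CovFeasible P F r f := by
  induction h using Reach.induction with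
  | init =>
    constructor
    · rintro r - q hq
      obtain ⟨rfl, rfl⟩ : q = P.start ∧ r = 0 := by simpa [initConfig] using hq
      exact Cov.start
    · rintro r - f hf g α rfl
      simp [window, proj] at hf
  | step u σ m τ h ih hs =>
    obtain ⟨ih₁, ih₂⟩ := ih ((List.prefix_append _ _).trans hu)
    have old : ∀ r ≤ K, ∀ q, (q, r) ∈ σ.locs →
        Cov P F r (window P r (u ++ firstWrite σ m)) q := fun r hr q hq =>
      (ih₁ r hr q hq).mono (window_prefix (List.prefix_append _ _))
    have hsync : ∀ r k, r ≤ k → k ≤ K → ∀ q, (q, r) ∈ σ.locs →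
        Cov P F r (sync P F r k (window P k (u ++ firstWrite σ m))) q := fun r k hrk hk q hq =>
      (old r (hrk.trans hk) q hq).mono (window_prefix_sync hw hrk hk hu)
    cases hs with
    | @incr q q' k ht hq =>
      refine ⟨?_, by simpa [firstWrite] using ih₂⟩
      rintro r hr p (hp | hp)
      · exact old r hr p hp
      · obtain ⟨rfl, rfl⟩ : p = q' ∧ r = k + 1 := by simpa using hp
        exact (hsync k (k + 1) (by omega) hr q hq).incr ht
    | @readValue q q' q₁ q₂ k i r₀ α x ht hq hx hr₀ hw₀ ht' hq₁ hq₂ =>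
      refine ⟨?_, by simpa [firstWrite] using ih₂⟩
      rintro r hr p (hp | hp)
      · exact old r hr p hp
      · obtain ⟨rfl, rfl⟩ : p = q' ∧ r = k := by simpa using hp
        have hi := P.read_le _ _ _ _ _ ht
        refine (old r hr q hq).readValue ht hx hr₀
          (mem_window.2 ⟨?_, by simp; omega, by simp; omega⟩)
          (hsync r₀ r (by omega) hr q₁ hq₁) (hsync r₀ r (by omega) hr q₂ hq₂) ht'
        exact List.mem_append_left _ (h.mem_written.1 hw₀)
    | @readBlank q q' k i α ht hq hb =>
      refine ⟨?_, by simpa [firstWrite] using ih₂⟩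
      rintro r hr p (hp | hp)
      · exact old r hr p hp
      · obtain ⟨rfl, rfl⟩ : p = q' ∧ r = k := by simpa using hp
        refine (old r hr q hq).readBlank ht fun r₀ hr₀ hmem => hb r₀ hr₀ ?_
        have := (mem_window.1 hmem).1
        exact h.mem_written.2 (by simpa [firstWrite] using this)
    | @write q q' k α x ht hq hx =>
      have hmem : (k, α) ∈ u ++ firstWrite σ ((q, Action.write α x, q'), k) := by
        by_cases hk : (k, α) ∈ σ.written
        · exact List.mem_append_left _ (h.mem_written.1 hk)
        · simp [firstWrite_write_of_notMem hk]
      constructor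
      · rintro r hr p (hp | hp)
        · exact old r hr p hp
        · obtain ⟨rfl, rfl⟩ : p = q' ∧ r = k := by simpa using hp
          exact (old r hr q hq).write ht (mem_window.2 ⟨hmem, by simp, by simp⟩)
      · by_cases hk : (k, α) ∈ σ.written
        · simpa [firstWrite_write_of_mem hk] using ih₂
        · rw [firstWrite_write_of_notMem hk]
          intro r hr f hf
          rw [window_append] at hf
          by_cases hkr : k ≤ r ∧ r ≤ k + P.vis
          · rw [window_singleton_of_mem (e := (k, α)) hkr.1 hkr.2] at hf
            rcases List.prefix_concat_iff.1 hf with rfl | hf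
            · intro g β hg
              obtain ⟨rfl, he⟩ := List.append_inj' hg rfl
              obtain ⟨rfl, rfl⟩ : k = r ∧ α = β := by simpa using he
              exact ⟨q, x, q', hx, ht, ih₁ k hr q hq⟩
            · exact ih₂ r hr f hf
          · have : window P r [(k, α)] = [] := by
              refine List.eq_nil_iff_forall_not_mem.2 fun e he => ?_
              obtain ⟨h1, h2, h3⟩ := mem_window.1 he
              obtain rfl := List.mem_singleton.1 h1
              exact hkr ⟨h2, h3⟩
            rw [this, List.append_nil] at hf
            exact ih₂ r hr f hf

theorem Reach.isChoice {w : List (Reg P.dim)} {σ : Config P} (h : Reach P w σ) (k : ℕ) :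
    IsChoice P (fun k => window P k w) k := by
  cases k with
  | zero =>
    exact ⟨h.nodup.filter _, fun r hr => by have := (mem_window.1 hr).2.1; omega⟩
  | succ k =>
    refine ⟨h.nodup.filter _, ?_⟩
    simp only [window, proj, List.filter_filter]
    apply List.filter_congr
    intro e _
    rw [← Bool.decide_and, ← Bool.decide_and, decide_eq_decide]
    omega

/-! ### Linearisation of a legal family -/

theorem isChoice_mem (hF : ∀ k, IsChoice P F k) (k : ℕ) {e : Reg P.dim} (he : e ∈ F k) :
    e.1 ≤ k ∧ k ≤ e.1 + P.vis := by
  induction k with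
  | zero => simp [(hF 0).2 e he]
  | succ k ih =>
    by_cases h : e.1 = k + 1
    · omega
    · have : e ∈ (F (k + 1)).filter (fun r => decide (r.1 ≠ k + 1)) := by
        simp [he, h]
      rw [(hF (k + 1)).2] at this
      simp only [List.mem_filter, decide_eq_true_eq] at this
      have := ih this.1
      omega

/-- The rounds up to `K` of a legal family are the windows of one sequence, in which no register
is directly followed by one that it does not see, if only earlier rounds are considered. -/
theorem exists_linearisation (hF : ∀ k, IsChoice P F k) (K : ℕ) :
    ∃ w : List (Reg P.dim), (∀ e ∈ w, e.1 ≤ K) ∧ (∀ r ≤ K, window P r w = F r) ∧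
      ∀ r ≤ K, (w.filter fun e => decide (e.1 ≤ r)).IsChain
        (fun y x => y.1 = r → r ≤ x.1 + P.vis) := by
  induction K with
  | zero =>
    refine ⟨F 0, fun e he => (isChoice_mem hF 0 he).1, ?_, ?_⟩
    · intro r hr
      obtain rfl : r = 0 := by omega
      refine List.filter_eq_self.2 fun e he => ?_
      simp [(hF 0).2 e he]
    · intro r hr
      obtain rfl : r = 0 := by omega
      exact List.Pairwise.isChain (List.pairwise_of_forall (by simp))
  | succ K ih =>
    obtain ⟨w, h1, h2, h3⟩ := ih
    have hcommon : w.filter (fun e => decide (¬ e.1 + P.vis < K + 1)) =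
        (F (K + 1)).filter (fun e => decide (¬ e.1 = K + 1)) := by
      have := (hF (K + 1)).2
      rw [← h2 K le_rfl, window, proj, List.filter_filter] at this
      rw [this]
      apply List.filter_congr
      intro e he
      have := h1 e he
      rw [← Bool.decide_and, decide_eq_decide]
      omega
    obtain ⟨c, c1, c2, c3⟩ := exists_merge (fun e : Reg P.dim => e.1 + P.vis < K + 1)
      (fun e => e.1 = K + 1) (fun x hx => by omega) w (F (K + 1)) hcommon
      (fun e he => by have := h1 e he; omega)
      (fun e he => by have := (isChoice_mem hF _ he).2; omega)
    have hc : ∀ e ∈ c, e.1 ≤ K + 1 := by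
      intro e he
      by_cases h : e.1 = K + 1
      · omega
      · have : e ∈ w := by rw [← c1]; simp [he, h]
        have := h1 e this
        omega
    refine ⟨c, hc, fun r hr => ?_, fun r hr => ?_⟩
    · rcases Nat.lt_or_ge K r with h | h
      · obtain rfl : r = K + 1 := by omega
        rw [← c2]
        apply List.filter_congr
        intro e he
        have := hc e he
        rw [decide_eq_decide]
        omega
      · rw [← h2 r h, ← c1, window, window, proj, proj, List.filter_filter]
        apply List.filter_congr
        intro e _
        rw [← Bool.decide_and, decide_eq_decide]
        omega
    · rcases Nat.lt_or_ge K r with h | h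
      · obtain rfl : r = K + 1 := by omega
        rw [List.filter_eq_self.2 (fun e he => by simpa using hc e he)]
        exact c3.imp fun y x hyx hy => by have := hyx hy; omega
      · convert h3 r h using 1
        rw [← c1, List.filter_filter]
        apply List.filter_congr
        intro e _
        rw [← Bool.decide_and, decide_eq_decide]
        omega

/-- The first register of `t` among those of rounds at most `r`, if any, is seen from round `r`. -/
def Ready (P : Protocol Q D) (r : ℕ) (t : List (Reg P.dim)) : Prop :=
  ∀ e, (t.filter fun e => decide (e.1 ≤ r)).head? = some e → r ≤ e.1 + P.vis

theorem Ready.of_cons {r : ℕ} {e : Reg P.dim} {t : List (Reg P.dim)} (h1 : e.1 ≤ r)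
    (h2 : r ≤ e.1 + P.vis) : Ready P r (e :: t) := by
  intro e' he'
  obtain rfl : e = e' := by simpa [h1] using he'
  exact h2

theorem head?_filter_of_isChain {d s v : ℕ} {l : List (Reg d)} (hl : ∀ e ∈ l, e.1 ≤ s + 1)
    (hc : l.IsChain (fun y x => y.1 = s + 1 → s + 1 ≤ x.1 + v))
    (hh : ∀ e, l.head? = some e → s + 1 ≤ e.1 + v) :
    ∀ e, (l.filter fun e => decide (e.1 ≤ s)).head? = some e → s + 1 ≤ e.1 + v := by
  induction l with
  | nil => simp
  | cons a l ih =>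
    rw [List.isChain_cons] at hc
    by_cases ha : a.1 ≤ s
    · intro e he
      obtain rfl : a = e := by simpa [ha] using he
      exact hh a rfl
    · rw [List.filter_cons_of_neg (by simpa using ha)]
      have := hl a (by simp)
      exact ih (fun e he => hl e (by simp [he])) hc.2
        (fun e he => hc.1 e (by simpa using he) (by omega))

theorem Ready.head?_pred {s : ℕ} {p t : List (Reg P.dim)}
    (hc : ((p ++ t).filter fun e => decide (e.1 ≤ s + 1)).IsChain
      (fun y x => y.1 = s + 1 → s + 1 ≤ x.1 + P.vis)) (h : Ready P (s + 1) t) :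
    ∀ e, (t.filter fun e => decide (e.1 ≤ s)).head? = some e → s + 1 ≤ e.1 + P.vis := by
  rw [List.filter_append] at hc
  have := head?_filter_of_isChain (fun e he => by simpa using (List.mem_filter.1 he).2)
    (List.isChain_append.1 hc).2.1 h
  rw [List.filter_filter] at this
  convert this using 6 with e e'
  rw [← Bool.decide_and, decide_eq_decide]
  omega

theorem syncStep_window {s : ℕ} {p t : List (Reg P.dim)} (hw : window P s (p ++ t) = F s)
    (ht : ∀ e, (t.filter fun e => decide (e.1 ≤ s)).head? = some e → s + 1 ≤ e.1 + P.vis) :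
    syncStep P F s (window P (s + 1) p) = window P s p := by
  obtain ⟨hproj, u, hu⟩ := syncStep_spec hw (List.prefix_append p t)
  obtain ⟨u', hu'⟩ := syncStep_prefix (F := F) s (window P (s + 1) p)
  rw [← hu] at hproj hu' ⊢
  rw [← hw, window_append, List.append_assoc, List.append_cancel_left_eq] at hu'
  cases u with
  | nil => simp
  | cons e u =>
    exfalso
    have hwt : window P s t = (t.filter fun e => decide (e.1 ≤ s)).filter
        fun e => decide (s ≤ e.1 + P.vis) := by
      rw [window, proj, List.filter_filter]
      apply List.filter_congr
      intro e _
      rw [← Bool.decide_and, decide_eq_decide]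
      omega
    rw [hwt] at hu'
    have he : e.1 ≤ s ∧ s + 1 ≤ e.1 + P.vis := by
      cases hf : t.filter fun e => decide (e.1 ≤ s) with
      | nil => simp [hf] at hu'
      | cons a l =>
        have ha := ht a (by simp [hf])
        rw [hf, List.filter_cons_of_pos (by simp; omega)] at hu'
        obtain rfl : e = a := (List.cons.inj hu').1
        have : e ∈ t.filter fun e => decide (e.1 ≤ s) := by simp [hf]
        exact ⟨by simpa using (List.mem_filter.1 this).2, ha⟩
    have hlen := congrArg List.length hproj
    rw [← proj_window (P := P) s p] at hlen
    have hpos : decide (s + 1 - P.vis ≤ e.1 ∧ e.1 ≤ s) = true := by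
      rw [decide_eq_true_eq]
      omega
    rw [proj, proj, List.filter_append, List.filter_cons_of_pos (by exact hpos)] at hlen
    simp at hlen

section Linear

variable {K : ℕ} {w : List (Reg P.dim)}

theorem Ready.of_succ {s : ℕ} {p t : List (Reg P.dim)}
    (hc : ((p ++ t).filter fun e => decide (e.1 ≤ s + 1)).IsChain
      (fun y x => y.1 = s + 1 → s + 1 ≤ x.1 + P.vis)) (h : Ready P (s + 1) t) : Ready P s t :=
  fun e he => by have := h.head?_pred hc e he; omega

theorem Ready.of_le {p t : List (Reg P.dim)}
    (hc : ∀ r ≤ K, ((p ++ t).filter fun e => decide (e.1 ≤ r)).IsChain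
      (fun y x => y.1 = r → r ≤ x.1 + P.vis)) {r k : ℕ} (hrk : r ≤ k) (hk : k ≤ K)
    (h : Ready P k t) : Ready P r t := by
  induction k, hrk using Nat.le_induction with
  | base => exact h
  | succ k _ ih => exact ih (by omega) (h.of_succ (hc _ hk))

theorem sync_window {p t : List (Reg P.dim)} (hw : ∀ r ≤ K, window P r (p ++ t) = F r)
    (hc : ∀ r ≤ K, ((p ++ t).filter fun e => decide (e.1 ≤ r)).IsChain
      (fun y x => y.1 = r → r ≤ x.1 + P.vis)) {r k : ℕ} (hrk : r ≤ k) (hk : k ≤ K)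
    (h : Ready P k t) : sync P F r k (window P k p) = window P r p := by
  induction k, hrk using Nat.le_induction with
  | base => exact sync_self _ _
  | succ k hrk ih =>
    rw [sync_succ hrk, syncStep_window (hw k (by omega)) (h.head?_pred (hc _ hk))]
    exact ih (by omega) (h.of_succ (hc _ hk))

/-! ### Executions that cover the variables of the algorithm -/

theorem Reach.exists_of_cov (hK : ∀ r ≤ K, window P r w = F r)
    (hc : ∀ r ≤ K, (w.filter fun e => decide (e.1 ≤ r)).IsChain
      (fun y x => y.1 = r → r ≤ x.1 + P.vis)) {p t : List (Reg P.dim)} (hpt : p ++ t = w)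
    {k : ℕ} {f : List (Reg P.dim)} {q : Q} (h : Cov P F k f q) (hk : k ≤ K)
    (ht : Ready P k t) (hf : f = window P k p) {σ : Config P} (hσ : Reach P p σ)
    (hold : ∀ p₁ e p₂, p₁ ++ e :: p₂ = p → ∀ r ≤ K, Ready P r (e :: p₂ ++ t) →
      ∀ q, Cov P F r (window P r p₁) q → (q, r) ∈ σ.locs) :
    ∃ σ', Reach P p σ' ∧ σ.locs ⊆ σ'.locs ∧ (q, k) ∈ σ'.locs := by
  subst hpt
  induction h generalizing σ with
  | start => exact ⟨σ, hσ, subset_rfl, hσ.start_mem⟩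
  | @ext k g e q h ih =>
    obtain ⟨p₁, p₂, rfl, rfl, h1, h2⟩ := window_eq_concat hf.symm
    exact ⟨σ, hσ, subset_rfl, hold p₁ e p₂ rfl k hk (Ready.of_cons h1 h2) q h⟩
  | @incr k f q q' h htr ih =>
    obtain ⟨σ', h1, h2, h3⟩ := ih (by omega) (ht.of_succ (hc _ hk))
      (by rw [hf]; exact sync_window hK hc (by omega) hk ht) hσ hold
    refine ⟨⟨σ'.locs ∪ {(q', k + 1)}, σ'.written⟩, ?_, h2.trans Set.subset_union_left,
      Or.inr rfl⟩
    simpa [firstWrite] using h1.step (Step.incr htr h3)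
  | @readBlank k j α f q q' h htr hr ih =>
    obtain ⟨σ', h1, h2, h3⟩ := ih hk ht hf hσ hold
    refine ⟨⟨σ'.locs ∪ {(q', k)}, σ'.written⟩, ?_, h2.trans Set.subset_union_left,
      Or.inr rfl⟩
    have hj := P.read_le _ _ _ _ _ htr
    have hb : ∀ r, r + j = k → (r, α) ∉ σ'.written := by
      intro r hrj hmem
      apply hr r hrj
      rw [hf]
      exact mem_window.2 ⟨h1.mem_written.1 hmem, by simp; omega, by simp; omega⟩
    simpa [firstWrite] using h1.step (Step.readBlank htr h3 hb)
  | @readValue k j r α x f q q' q₁ q₂ h htr hx hr hrf h₁ h₂ htr' ih ih₁ ih₂ =>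
    have hrk : r ≤ k := by omega
    have hs : sync P F r k f = window P r p := by
      rw [hf]; exact sync_window hK hc hrk hk ht
    have htr₀ := ht.of_le hc hrk hk
    obtain ⟨σ', a1, a2, a3⟩ := ih hk ht hf hσ hold
    have hold' : ∀ {τ : Config P}, σ.locs ⊆ τ.locs → ∀ p₁ e p₂, p₁ ++ e :: p₂ = p → ∀ r ≤ K,
        Ready P r (e :: p₂ ++ t) → ∀ q, Cov P F r (window P r p₁) q → (q, r) ∈ τ.locs :=
      fun hτ p₁ e p₂ he r hr hR q hq => hτ (hold p₁ e p₂ he r hr hR q hq)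
    obtain ⟨σ₁, b1, b2, b3⟩ := ih₁ (hrk.trans hk) htr₀ hs a1 (hold' a2)
    obtain ⟨σ₂, c1, c2, c3⟩ := ih₂ (hrk.trans hk) htr₀ hs b1 (hold' (a2.trans b2))
    refine ⟨⟨σ₂.locs ∪ {(q', k)}, σ₂.written⟩, ?_, ((a2.trans b2).trans c2).trans Set.subset_union_left,
      Or.inr rfl⟩
    have hmem : (r, α) ∈ σ₂.written := by
      rw [hf] at hrf
      exact c1.mem_written.2 (mem_window.1 hrf).1
    simpa [firstWrite] using
      c1.step (Step.readValue htr (c2 (b2 a3)) hx hr hmem htr' (c2 b3) c3)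
  | @write k α x f q q' h htr hr ih =>
    obtain ⟨σ', h1, h2, h3⟩ := ih hk ht hf hσ hold
    refine ⟨⟨σ'.locs ∪ {(q', k)}, σ'.written ∪ {(k, α)}⟩, ?_, h2.trans Set.subset_union_left,
      Or.inr rfl⟩
    have hmem : (k, α) ∈ σ'.written := by
      rw [hf] at hr
      exact h1.mem_written.2 (mem_window.1 hr).1
    simpa [firstWrite_write_of_mem hmem] using
      h1.step (Step.write htr h3 (P.write_ne _ _ _ _ htr))

theorem Reach.exists_saturated [Finite Q] (hK : ∀ r ≤ K, window P r w = F r)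
    (hc : ∀ r ≤ K, (w.filter fun e => decide (e.1 ≤ r)).IsChain
      (fun y x => y.1 = r → r ≤ x.1 + P.vis)) {p t : List (Reg P.dim)} (hpt : p ++ t = w)
    {σ : Config P} (hσ : Reach P p σ)
    (hold : ∀ p₁ e p₂, p₁ ++ e :: p₂ = p → ∀ r ≤ K, Ready P r (e :: p₂ ++ t) →
      ∀ q, Cov P F r (window P r p₁) q → (q, r) ∈ σ.locs) :
    ∃ σ', Reach P p σ' ∧ ∀ p₁ p₂, p₁ ++ p₂ = p → ∀ r ≤ K, Ready P r (p₂ ++ t) →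
      ∀ q, Cov P F r (window P r p₁) q → (q, r) ∈ σ'.locs := by
  let goals : Set (Q × ℕ) :=
    {x | x.2 ≤ K ∧ Ready P x.2 t ∧ Cov P F x.2 (window P x.2 p) x.1}
  have hfin : goals.Finite := by
    refine ((Set.finite_univ (α := Q)).prod (Set.finite_Iic K)).subset ?_
    rintro ⟨q, r⟩ hx
    exact ⟨Set.mem_univ _, hx.1⟩
  have H : ∃ σ', Reach P p σ' ∧ σ.locs ⊆ σ'.locs ∧ goals ⊆ σ'.locs := by
    refine Set.Finite.induction_on_subset
      (motive := fun G _ => ∃ σ', Reach P p σ' ∧ σ.locs ⊆ σ'.locs ∧ G ⊆ σ'.locs) goals hfin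
      ⟨σ, hσ, subset_rfl, Set.empty_subset _⟩ ?_
    rintro ⟨q, r⟩ G hx _ _ ⟨σ₁, h1, h2, h3⟩
    obtain ⟨σ₂, g1, g2, g3⟩ := h1.exists_of_cov hK hc hpt hx.2.2 hx.1 hx.2.1 rfl
      (fun p₁ e p₂ he r hr hR q hq => h2 (hold p₁ e p₂ he r hr hR q hq))
    exact ⟨σ₂, g1, h2.trans g2, Set.insert_subset g3 (h3.trans g2)⟩
  obtain ⟨σ', h1, h2, h3⟩ := H
  refine ⟨σ', h1, fun p₁ p₂ he r hr hR q hq => ?_⟩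
  cases p₂ with
  | nil =>
    obtain rfl : p₁ = p := by simpa using he
    exact h3 ⟨hr, hR, hq⟩
  | cons e p₂ => exact h2 (hold p₁ e p₂ he r hr hR q hq)

theorem exists_saturated [Finite Q] (hF : ∀ k, IsChoice P F k)
    (hfeas : ∀ k f, f <+: F k → CovFeasible P F k f) (hle : ∀ e ∈ w, e.1 ≤ K)
    (hK : ∀ r ≤ K, window P r w = F r)
    (hc : ∀ r ≤ K, (w.filter fun e => decide (e.1 ≤ r)).IsChain
      (fun y x => y.1 = r → r ≤ x.1 + P.vis)) {p t : List (Reg P.dim)} (hpt : p ++ t = w) :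
    ∃ σ, Reach P p σ ∧ ∀ p₁ p₂, p₁ ++ p₂ = p → ∀ r ≤ K, Ready P r (p₂ ++ t) →
      ∀ q, Cov P F r (window P r p₁) q → (q, r) ∈ σ.locs := by
  induction p using List.reverseRecOn generalizing t with
  | nil => exact Reach.exists_saturated hK hc hpt ⟨Exec.nil _, rfl⟩ (by simp)
  | append_singleton p e ih =>
    obtain ⟨k, α⟩ := e
    obtain ⟨σ, h1, h2⟩ := ih (t := (k, α) :: t) (by simpa using hpt)
    have hkK : k ≤ K := hle (k, α) (by simp [← hpt])
    have hwin : window P k (p ++ [(k, α)]) = window P k p ++ [(k, α)] := by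
      rw [window_append, window_singleton_of_mem (e := (k, α)) le_rfl (Nat.le_add_right _ _)]
    have hpre : window P k p ++ [(k, α)] <+: F k := by
      rw [← hwin, ← hK k hkK, ← hpt]
      exact window_prefix (List.prefix_append _ _)
    obtain ⟨q, x, q', hx, htr, hq⟩ := hfeas k _ hpre _ _ rfl
    have hqσ : (q, k) ∈ σ.locs :=
      h2 p [] (by simp) k hkK (Ready.of_cons le_rfl (Nat.le_add_right _ _)) q hq
    have hnew : (k, α) ∉ σ.written := by
      rw [h1.mem_written]
      intro hmem
      have hnd : (F k).Nodup := by
        cases k with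
        | zero => exact (hF 0).1
        | succ k => exact (hF (k + 1)).1
      have := hnd.sublist hpre.sublist
      exact (List.nodup_append.1 this).2.2 (k, α)
        (mem_window.2 ⟨hmem, le_rfl, Nat.le_add_right _ _⟩) (k, α) (by simp) rfl
    have hstep := h1.step (Step.write htr hqσ hx)
    rw [firstWrite_write_of_notMem hnew] at hstep
    refine hstep.exists_saturated hK hc hpt fun p₁ e p₂ he r hr hR q₀ hq₀ => Or.inl ?_
    rcases List.eq_nil_or_concat' p₂ with rfl | ⟨p₃, e', rfl⟩
    · obtain ⟨rfl, he'⟩ := List.append_inj' he rfl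
      obtain rfl : e = (k, α) := by simpa using he'
      exact h2 p₁ [] (by simp) r hr hR q₀ hq₀
    · have he'' : (p₁ ++ e :: p₃) ++ [e'] = p ++ [(k, α)] := by simpa using he
      obtain ⟨rfl, he'⟩ := List.append_inj' he'' rfl
      obtain rfl : e' = (k, α) := by simpa using he'
      exact h2 p₁ (e :: p₃) rfl r hr (by simpa using hR) q₀ hq₀

end Linear

theorem stateReach_eq [Finite Q] (hF : ∀ k, IsChoice P F k)
    (hfeas : ∀ k f, f <+: F k → CovFeasible P F k f) (k : ℕ) :
    {q | Cov P F k (F k) q} = stateReach P F k := by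
  apply Set.Subset.antisymm
  · intro q hq
    obtain ⟨w, h1, h2, h3⟩ := exists_linearisation hF k
    obtain ⟨σ, ⟨ρ, hρ⟩, h⟩ := exists_saturated hF hfeas h1 h2 h3 (List.append_nil w)
    refine ⟨σ, ρ, h w [] (by simp) k le_rfl (by simp [Ready]) q ?_, ?_⟩
    · rw [h2 k le_rfl]
      exact hq
    · rw [hρ]
      exact h2
  · rintro q ⟨σ, ρ, hq, hw⟩
    have := (Reach.cov hw ⟨ρ, rfl⟩ List.prefix_rfl).1 k le_rfl q hq
    rwa [hw k le_rfl] at this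

end RoundBased

theorem mainTheorem4 {Q : Type*} {D : Type*} [Finite Q] [Finite D]
    (P : RoundBased.Protocol Q D) :
    (∀ F : RoundBased.Family P, RoundBased.NonRejecting P F →
      ∀ k K : ℕ, k < K → ∃ S : RoundBased.Store P,
        RoundBased.run P F K = some S ∧ S k (F k) = RoundBased.stateReach P F k) ∧
    (∀ (σ : RoundBased.Config P) (ρ : RoundBased.Exec P (RoundBased.initConfig P) σ),
      RoundBased.NonRejecting P (fun k => RoundBased.window P k (RoundBased.fwo ρ))) := by
  constructor
  · rintro F ⟨hF, hrun⟩ k K hkK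
    obtain ⟨S, h1, h2⟩ := RoundBased.run_eq_of_ne_none (hrun K)
    refine ⟨S, h1, ?_⟩
    rw [h2 k hkK]
    exact RoundBased.stateReach_eq hF ((RoundBased.run_ne_none_iff P F).1 hrun) k
  · intro σ ρ
    have h : RoundBased.Reach P (RoundBased.fwo ρ) σ := ⟨ρ, rfl⟩
    refine ⟨h.isChoice, (RoundBased.run_ne_none_iff P _).2 fun k f hf => ?_⟩
    exact (h.cov (K := k) (fun r _ => rfl) List.prefix_rfl).2 k le_rfl f hf
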